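/- Let $(\Omega,\mu)$ be a finite measure space, let $k\ge 1$, and let $S_1,\dots,S_k\subseteq\Omega$ be distinct measurable sets such that $\mu(S_i)>0$ for every $i$ and $\mu(S_i\triangle S_j)>0$ for all $i\neq j$. Let $\omega_1,\omega_2,\dots$ be independent random points of $\Omega$, each with distribution $\mu/\mu(\Omega)$. Define $\mathcal R_0=\{S_1,\dots,S_k\}$ and, for $n\ge 1$, $$\mathcal R_n=\begin{cases}\mathcal R_{n-1}\setminus\{S\in\mathcal R_{n-1}:\omega_n\in S\}, & \text{if } \omega_n\notin S' \text{ for some } S'\in\mathcal R_{n-1},\\ \mathcal R_{n-1}, & \text{otherwise.}\end{cases}$$ Then with probability $1$ the family $\bigcap_{n\ge 0}\mathcal R_n$ has exactly one element, the winning set $\mathrm{win}$, and its expected measure satisfies $$\mathbf E[\mu(\mathrm{win})]\le (2\ln k+2)\cdot\min_{1\le i\le k}\mu(S_i).$$ -/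

import Mathlib

open MeasureTheory ProbabilityTheory

noncomputable section

namespace SetElimination

/-- The family of remaining sets after `n` rounds of the set elimination game on the initial
family `I`, when the drawn points are `ω 0, ω 1, ω 2, …` (the point `ω n` is drawn in round
`n + 1`). In each round all remaining sets that contain the drawn point are removed, provided
that some remaining set does not contain it; otherwise nothing is removed. -/
def remaining {Ω : Type*} (I : Set (Set Ω)) (ω : ℕ → Ω) : ℕ → Set (Set Ω)
  | 0 => I
  | n + 1 =>
      open scoped Classical in
      if ∃ S ∈ remaining I ω n, ω n ∉ S then
        remaining I ω n \ {S ∈ remaining I ω n | ω n ∈ S}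
      else remaining I ω n

/-- `W` is the winner of the game: it is the unique set that is never eliminated. -/
def IsWinner {Ω : Type*} (I : Set (Set Ω)) (ω : ℕ → Ω) (W : Set Ω) : Prop :=
  (⋂ n, remaining I ω n) = {W}

/-- The winner of the game, with the convention `∅` if there is no winner. -/
def win {Ω : Type*} (I : Set (Set Ω)) (ω : ℕ → Ω) : Set Ω :=
  open scoped Classical in
  if h : ∃ W, IsWinner I ω W then h.choose else ∅

end SetElimination

end

/-!
Fix a member `M` of the family, to be chosen of least measure, and write `ν` for the law of the
drawn points. Since `μ(win) ≤ μ(M) + μ(win \ M)`, it suffices to bound the expectation of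
`ν(win \ M)` by `(2 ln k + 1) ν(M)`.

If the winner is not `M`, then `M` is eliminated in some round by a point `x ∈ M`. Take `x` out of
the sequence and let `b` be the remaining points; `x` and `b` are independent, and `b` is again
i.i.d. (`measurePreserving_insertAt`). The key observation is that the winner does not depend on
the round in which `x` was drawn: as long as some set avoiding `x` remains, the game treats the
sets avoiding `x` exactly like the game played on these sets alone (`remaining_inter_eq`), so the
winner `V` is the winner of the game on the sets avoiding `x`, driven by `b` from the start
(`IsWinner.of_insertAt`). Moreover `M` and `V` both remain up to the round of `x`, so the points
of `b` before it avoid `V \ M` (`IsWinner.notMem_diff`). Summing over the rounds, the expectation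
of `ν(win \ M)` is at most the expectation, over `x ∈ M` and `b`, of `ν(V \ M) N_V`, where `N_T` is
the number of `n` such that the first `n` points of `b` avoid `T \ M`.

Each `N_T` is geometric with success probability `ν(T \ M)`, so the excess of `ν(T \ M) N_T` over
`c` has expectation at most `exp(1 - c)` (`exists_avoiding_excess`). With `c = 2 ln k`, the sum
over the `k - 1` sets `T ≠ M` is at most `e (k - 1) / k² ≤ 1`, which gives the factor `2 ln k + 1`
(`sum_isWinner_mul_diff_le`).

Almost surely there is a winner because every two sets are separated by some drawn point
(`ae_exists_isWinner`).
-/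

/-! ### The deterministic game -/

namespace SetElimination

variable {Ω : Type*} {I J : Set (Set Ω)} {ω ω' : ℕ → Ω} {T M W : Set Ω} {n : ℕ}

theorem mem_remaining_succ :
    T ∈ remaining I ω (n + 1) ↔
      T ∈ remaining I ω n ∧ (ω n ∉ T ∨ ∀ T' ∈ remaining I ω n, ω n ∈ T') := by
  rw [remaining]
  split_ifs with h
  · have h' : ¬ ∀ T' ∈ remaining I ω n, ω n ∈ T' := by push Not; exact h
    simp only [Set.mem_sdiff, Set.mem_ofPred_eq, h', or_false]
    tauto
  · push Not at h
    exact ⟨fun hT => ⟨hT, Or.inr h⟩, And.left⟩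

theorem remaining_antitone : Antitone (remaining I ω) :=
  antitone_nat_of_succ_le fun _ _ hT => (mem_remaining_succ.1 hT).1

theorem remaining_subset : remaining I ω n ⊆ I := remaining_antitone (Nat.zero_le n)

theorem remaining_nonempty (hI : I.Nonempty) : (remaining I ω n).Nonempty := by
  induction n with
  | zero => exact hI
  | succ n ih =>
    by_cases h : ∀ T' ∈ remaining I ω n, ω n ∈ T'
    · obtain ⟨T, hT⟩ := ih
      exact ⟨T, mem_remaining_succ.2 ⟨hT, Or.inr h⟩⟩
    · push Not at h
      obtain ⟨T, hT, hTω⟩ := h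
      exact ⟨T, mem_remaining_succ.2 ⟨hT, Or.inl hTω⟩⟩

theorem remaining_congr (h : ∀ m < n, ω m = ω' m) : remaining I ω n = remaining I ω' n := by
  induction n with
  | zero => rfl
  | succ n ih =>
    ext T
    rw [mem_remaining_succ, mem_remaining_succ, ih fun m hm => h m (hm.trans n.lt_succ_self),
      h n n.lt_succ_self]

/-- As long as the game on `I` keeps some member of a subfamily `J`, it acts on `J` exactly like
the game on `J` alone: the rule protecting the last remaining sets has not yet applied to `J`. -/
theorem remaining_inter_eq (hJ : J ⊆ I) (h : (remaining I ω n ∩ J).Nonempty) :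
    remaining I ω n ∩ J = remaining J ω n := by
  induction n with
  | zero => exact Set.inter_eq_right.2 hJ
  | succ n ih =>
    obtain ⟨U, hU, hUJ⟩ := h
    have hU' := mem_remaining_succ.1 hU
    have ih := ih ⟨U, hU'.1, hUJ⟩
    ext T
    rw [Set.mem_inter_iff, mem_remaining_succ, mem_remaining_succ, ← ih]
    constructor
    · rintro ⟨⟨hT, h⟩, hTJ⟩
      exact ⟨⟨hT, hTJ⟩, h.imp_right fun h T' hT' => h T' hT'.1⟩
    · rintro ⟨⟨hT, hTJ⟩, h⟩
      refine ⟨⟨hT, h.imp_right fun h => ?_⟩, hTJ⟩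
      exact hU'.2.resolve_left (not_not.2 (h U ⟨hU'.1, hUJ⟩))

theorem isWinner_iff : IsWinner I ω W ↔ ∀ T, (∀ n, T ∈ remaining I ω n) ↔ T = W := by
  simp [IsWinner, Set.ext_iff]

theorem IsWinner.mem_remaining (h : IsWinner I ω W) (n : ℕ) : W ∈ remaining I ω n :=
  (isWinner_iff.1 h W).2 rfl n

theorem IsWinner.mem (h : IsWinner I ω W) : W ∈ I := h.mem_remaining 0

theorem IsWinner.unique (h : IsWinner I ω W) (h' : IsWinner I ω T) : W = T :=
  Set.singleton_injective (h.symm.trans h')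

theorem IsWinner.win_eq (h : IsWinner I ω W) : win I ω = W := by
  have h' : ∃ W, IsWinner I ω W := ⟨W, h⟩
  rw [win, dif_pos h']
  exact h'.choose_spec.unique h

theorem win_eq_empty (h : ¬ ∃ W, IsWinner I ω W) : win I ω = ∅ := dif_neg h

/-- In a finite nonempty family some set is never eliminated, and two survivors are never
separated by a drawn point. -/
theorem exists_isWinner (hfin : I.Finite) (hne : I.Nonempty)
    (hsep : ∀ T ∈ I, ∀ T' ∈ I, T ≠ T' → ∃ n, ω n ∈ symmDiff T T') :
    ∃ W, IsWinner I ω W := by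
  have hex : ∃ W, ∀ n, W ∈ remaining I ω n := by
    by_contra! h
    choose f hf using h
    obtain ⟨N, hN⟩ := (hfin.image f).bddAbove
    obtain ⟨T, hT⟩ := remaining_nonempty (ω := ω) (n := N) hne
    exact hf T (remaining_antitone (hN ⟨T, remaining_subset hT, rfl⟩) hT)
  obtain ⟨W, hW⟩ := hex
  refine ⟨W, isWinner_iff.2 fun T => ⟨fun hT => ?_, fun h => h ▸ hW⟩⟩
  by_contra hne
  obtain ⟨n, hn⟩ := hsep T (hT 0) W (hW 0) hne
  rcases hn with ⟨h1, h2⟩ | ⟨h1, h2⟩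
  · exact (mem_remaining_succ.1 (hT (n + 1))).2.elim (fun h => h h1) fun h => h2 (h W (hW n))
  · exact (mem_remaining_succ.1 (hW (n + 1))).2.elim (fun h => h h1) fun h => h2 (h T (hT n))

/-! ### Moving the point that eliminates a set to the front -/

/-- The sequence `b` with the point `x` inserted at position `n`. -/
def insertAt (n : ℕ) (x : Ω) (b : ℕ → Ω) (m : ℕ) : Ω :=
  if m < n then b m else if m = n then x else b (m - 1)

theorem insertAt_of_lt (x : Ω) (b : ℕ → Ω) {m : ℕ} (h : m < n) : insertAt n x b m = b m :=
  if_pos h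

theorem insertAt_self (x : Ω) (b : ℕ → Ω) : insertAt n x b n = x := by simp [insertAt]

theorem insertAt_add (x : Ω) (b : ℕ → Ω) (j : ℕ) : insertAt n x b (n + 1 + j) = b (n + j) := by
  have h1 : ¬ n + 1 + j < n := by omega
  have h2 : n + 1 + j ≠ n := by omega
  simp only [insertAt, if_neg h1, if_neg h2]
  congr 1
  omega

/-- If the inserted point `x` eliminates a set in round `n + 1`, then from that round on the game
agrees with the game on the sets avoiding `x` that is played with `b` from the start. -/
theorem remaining_insertAt {x : Ω} {b : ℕ → Ω} (hM : M ∈ remaining I (insertAt n x b) n)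
    (hM' : M ∉ remaining I (insertAt n x b) (n + 1)) (j : ℕ) :
    remaining I (insertAt n x b) (n + 1 + j) = remaining {T ∈ I | x ∉ T} b (n + j) := by
  have hb : remaining I (insertAt n x b) n = remaining I b n :=
    remaining_congr fun m hm => insertAt_of_lt x b hm
  induction j with
  | zero =>
    rw [mem_remaining_succ, insertAt_self, not_and_or, not_or] at hM'
    have hx := (hM'.resolve_left (not_not.2 hM)).2
    push Not at hx
    obtain ⟨U, hU, hxU⟩ := hx
    rw [hb] at hU
    rw [add_zero, add_zero,
      ← remaining_inter_eq (Set.sep_subset _ _) ⟨U, hU, remaining_subset hU, hxU⟩]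
    ext T
    rw [mem_remaining_succ, insertAt_self, hb]
    constructor
    · rintro ⟨hT, h⟩
      exact ⟨hT, remaining_subset hT, h.resolve_right fun h => hxU (h U hU)⟩
    · rintro ⟨hT, -, h⟩
      exact ⟨hT, Or.inl h⟩
  | succ j ih =>
    ext T
    rw [← add_assoc, ← add_assoc, mem_remaining_succ, mem_remaining_succ, ih, insertAt_add]

theorem mem_of_eliminated {x : Ω} {b : ℕ → Ω} (hM : M ∈ remaining I (insertAt n x b) n)
    (hM' : M ∉ remaining I (insertAt n x b) (n + 1)) : x ∈ M := by
  by_contra hx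
  exact hM' (mem_remaining_succ.2 ⟨hM, Or.inl (by rwa [insertAt_self])⟩)

/-- If `M` is eliminated by the inserted point `x`, the winner is determined by `x` and `b` alone,
irrespective of the position at which `x` is inserted. -/
theorem IsWinner.of_insertAt {x : Ω} {b : ℕ → Ω} (hW : IsWinner I (insertAt n x b) W)
    (hM : M ∈ remaining I (insertAt n x b) n)
    (hM' : M ∉ remaining I (insertAt n x b) (n + 1)) :
    IsWinner {T ∈ I | x ∉ T} b W := by
  rw [isWinner_iff] at hW ⊢
  intro T
  rw [← hW T]
  have key := remaining_insertAt hM hM'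
  constructor
  · intro h m
    refine remaining_antitone (Nat.le_add_left m (n + 1)) ?_
    rw [key]
    exact h _
  · intro h m
    refine remaining_antitone (Nat.le_add_left m n) ?_
    rw [← key]
    exact h _

/-- While both `M` and the eventual winner `W` remain, no drawn point lies in `W \ M`. -/
theorem IsWinner.notMem_diff {x : Ω} {b : ℕ → Ω} (hW : IsWinner I (insertAt n x b) W)
    (hM : M ∈ remaining I (insertAt n x b) n) {j : ℕ} (hj : j < n) : b j ∉ W \ M := by
  rintro ⟨h1, h2⟩
  rw [← insertAt_of_lt x b hj] at h1 h2
  exact (mem_remaining_succ.1 (hW.mem_remaining (j + 1))).2.elim (fun h => h h1)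
    fun h => h2 (h M (remaining_antitone hj.le hM))

theorem IsWinner.exists_eliminated (hW : IsWinner I ω W) (hM : M ∈ I) (hne : W ≠ M) :
    ∃ n, M ∈ remaining I ω n ∧ M ∉ remaining I ω (n + 1) := by
  by_contra! h
  exact hne ((isWinner_iff.1 hW M).1 fun n => Nat.rec hM h n).symm

end SetElimination

/-! ### Independent draws and measurability -/

namespace SetElimination

open scoped ENNReal

variable {Ω Z : Type*} [MeasurableSpace Ω] [MeasurableSpace Z] {ι : Type*}

theorem measurable_insertAt (n : ℕ) :
    Measurable fun z : Ω × (ℕ → Ω) => insertAt n z.1 z.2 := by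
  refine measurable_pi_lambda _ fun m => ?_
  unfold insertAt
  split_ifs <;> fun_prop

/-- Inserting an independent point of law `ν` into an i.i.d. sequence of law `ν` gives again such
a sequence. -/
theorem measurePreserving_insertAt (ν : Measure Ω) [IsProbabilityMeasure ν] (n : ℕ) :
    MeasurePreserving (fun z : Ω × (ℕ → Ω) => insertAt n z.1 z.2)
      (ν.prod (Measure.infinitePi fun _ => ν)) (Measure.infinitePi fun _ => ν) := by
  refine ⟨measurable_insertAt n, Measure.eq_infinitePi _ fun s t ht => ?_⟩
  rw [Measure.map_apply (measurable_insertAt n)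
    (MeasurableSet.pi s.countable_toSet fun i _ => ht i)]
  -- `d` enumerates the positions other than `n`.
  let d : ℕ → ℕ := fun j => if j < n then j else j + 1
  have hd : Function.Injective d := by
    intro i j hij
    simp only [d] at hij
    split_ifs at hij <;> omega
  have hdn : ∀ j, d j ≠ n := by
    intro j
    simp only [d]
    split_ifs <;> omega
  have hdr : ∀ m, m ≠ n → m ∈ Set.range d := by
    intro m hm
    rcases lt_or_gt_of_ne hm with h | h
    · exact ⟨m, if_pos h⟩
    · refine ⟨m - 1, ?_⟩
      simp only [d]
      split_ifs <;> omega
  have hins : ∀ (x : Ω) (b : ℕ → Ω) j, insertAt n x b (d j) = b j := by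
    intro x b j
    simp only [d]
    split_ifs with h
    · exact insertAt_of_lt x b h
    · obtain ⟨i, rfl⟩ := Nat.exists_eq_add_of_le (not_lt.1 h)
      rw [← insertAt_add x b i]
      congr 1
      omega
  let s' : Finset ℕ := (s.erase n).preimage d hd.injOn
  have hpre : (fun z : Ω × (ℕ → Ω) => insertAt n z.1 z.2) ⁻¹' Set.pi s t =
      (if n ∈ s then t n else Set.univ) ×ˢ Set.pi s' fun j => t (d j) := by
    ext ⟨x, b⟩
    simp only [Set.mem_preimage, Set.mem_pi, Set.mem_prod, Finset.mem_coe, s',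
      Finset.mem_preimage, Finset.mem_erase]
    constructor
    · intro h
      refine ⟨?_, fun j hj => hins x b j ▸ h _ hj.2⟩
      split_ifs with hn
      · exact insertAt_self (n := n) x b ▸ h n hn
      · trivial
    · rintro ⟨h1, h2⟩ m hm
      by_cases hmn : m = n
      · subst hmn
        rw [if_pos hm] at h1
        rwa [insertAt_self]
      · obtain ⟨j, rfl⟩ := hdr m hmn
        rw [hins]
        exact h2 j ⟨hmn, hm⟩
  rw [hpre, Measure.prod_prod, Measure.infinitePi_pi _ fun _ _ => ht _,
    Finset.prod_preimage d (s.erase n) hd.injOn (fun m => ν (t m))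
      fun m hm hm' => absurd (hdr m (Finset.ne_of_mem_erase hm)) hm']
  split_ifs with hn
  · exact Finset.mul_prod_erase s (fun m => ν (t m)) hn
  · rw [measure_univ, one_mul, Finset.erase_eq_of_notMem hn]

theorem measurableSet_mem_remaining [Countable ι] {S : ι → Set Ω} (hS : ∀ i, MeasurableSet (S i))
    {I : Z → Set (Set Ω)} (hI : ∀ z, I z ⊆ Set.range S)
    (hIm : ∀ i, MeasurableSet {z | S i ∈ I z}) {b : Z → ℕ → Ω} (hb : ∀ n, Measurable fun z => b z n)
    (n : ℕ) (i : ι) : MeasurableSet {z | S i ∈ remaining (I z) (b z) n} := by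
  induction n generalizing i with
  | zero => exact hIm i
  | succ n ih =>
    have h : {z | S i ∈ remaining (I z) (b z) (n + 1)} =
        {z | S i ∈ remaining (I z) (b z) n} ∩ ({z | b z n ∈ S i}ᶜ ∪
          ⋂ j, ({z | S j ∈ remaining (I z) (b z) n}ᶜ ∪ {z | b z n ∈ S j})) := by
      ext z
      have hall : (∀ T ∈ remaining (I z) (b z) n, b z n ∈ T) ↔
          ∀ j, S j ∈ remaining (I z) (b z) n → b z n ∈ S j := by
        refine ⟨fun h j hj => h _ hj, fun h T hT => ?_⟩
        obtain ⟨j, rfl⟩ := hI z (remaining_subset hT)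
        exact h j hT
      rw [Set.mem_ofPred_eq, mem_remaining_succ, hall]
      simp only [Set.mem_ofPred_eq, Set.mem_inter_iff, Set.mem_union, Set.mem_compl_iff,
        Set.mem_iInter, imp_iff_not_or]
    rw [h]
    have hbS : ∀ j, MeasurableSet {z | b z n ∈ S j} := fun j => hb n (hS j)
    exact (ih i).inter ((hbS i).compl.union (.iInter fun j => (ih j).compl.union (hbS j)))

theorem measurableSet_isWinner [Countable ι] {S : ι → Set Ω} (hS : ∀ i, MeasurableSet (S i))
    {I : Z → Set (Set Ω)} (hI : ∀ z, I z ⊆ Set.range S)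
    (hIm : ∀ i, MeasurableSet {z | S i ∈ I z}) {b : Z → ℕ → Ω} (hb : ∀ n, Measurable fun z => b z n)
    (i : ι) : MeasurableSet {z | IsWinner (I z) (b z) (S i)} := by
  have h : {z | IsWinner (I z) (b z) (S i)} =
      (⋂ n, {z | S i ∈ remaining (I z) (b z) n}) ∩
        ⋂ j, ((⋂ n, {z | S j ∈ remaining (I z) (b z) n})ᶜ ∪ {_z | S j = S i}) := by
    ext z
    simp only [Set.mem_ofPred_eq, isWinner_iff, Set.mem_inter_iff, Set.mem_iInter, Set.mem_union,
      Set.mem_compl_iff, ← imp_iff_not_or]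
    constructor
    · exact fun h => ⟨(h _).2 rfl, fun j => (h _).1⟩
    · rintro ⟨h1, h2⟩ T
      refine ⟨fun hT => ?_, fun hT => hT ▸ h1⟩
      obtain ⟨j, rfl⟩ := hI z (hT 0)
      exact h2 j hT
  rw [h]
  have hr := measurableSet_mem_remaining hS hI hIm hb
  exact (MeasurableSet.iInter fun n => hr n i).inter
    (.iInter fun j => (MeasurableSet.iInter fun n => hr n j).compl.union (.const _))

variable (ν : Measure Ω) [IsProbabilityMeasure ν]

/-- The sequences whose first `n` terms avoid `B`. -/
def avoiding (B : Set Ω) (n : ℕ) : Set (ℕ → Ω) := Set.pi (Finset.range n) fun _ => Bᶜ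

theorem measurableSet_avoiding {B : Set Ω} (hB : MeasurableSet B) (n : ℕ) :
    MeasurableSet (avoiding B n) :=
  MeasurableSet.pi (Finset.countable_toSet _) fun _ _ => hB.compl

theorem infinitePi_avoiding {B : Set Ω} (hB : MeasurableSet B) (n : ℕ) :
    Measure.infinitePi (fun _ : ℕ => ν) (avoiding B n) = (1 - ν B) ^ n := by
  rw [avoiding, Measure.infinitePi_pi _ fun _ _ => hB.compl, prob_compl_eq_one_sub hB]
  simp

theorem ae_exists_mem {B : Set Ω} (hB : MeasurableSet B) (hpos : 0 < ν B) :
    ∀ᵐ b ∂Measure.infinitePi (fun _ : ℕ => ν), ∃ n, b n ∈ B := by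
  rw [ae_iff, ← nonpos_iff_eq_zero]
  have hlt : 1 - ν B < 1 := ENNReal.sub_lt_self ENNReal.one_ne_top one_ne_zero hpos.ne'
  refine ge_of_tendsto' (ENNReal.tendsto_pow_atTop_nhds_zero_of_lt_one hlt) fun n => ?_
  rw [← infinitePi_avoiding ν hB]
  refine measure_mono fun b hb => ?_
  simp only [Set.mem_ofPred_eq, not_exists] at hb
  exact fun j _ => hb j

theorem ae_exists_isWinner [Finite ι] [Nonempty ι] {S : ι → Set Ω}
    (hS : ∀ i, MeasurableSet (S i)) (hdiff : ∀ i j, i ≠ j → 0 < ν (symmDiff (S i) (S j))) :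
    ∀ᵐ b ∂Measure.infinitePi (fun _ : ℕ => ν), ∃ W, IsWinner (Set.range S) b W := by
  have h : ∀ i j, ∀ᵐ b ∂Measure.infinitePi (fun _ : ℕ => ν),
      i ≠ j → ∃ n, b n ∈ symmDiff (S i) (S j) := by
    intro i j
    by_cases hij : i = j
    · simp [hij]
    · filter_upwards [ae_exists_mem ν ((hS i).symmDiff (hS j)) (hdiff i j hij)] with b hb _
      exact hb
  filter_upwards [ae_all_iff.2 fun i => ae_all_iff.2 (h i)] with b hb
  refine exists_isWinner (Set.finite_range S) (Set.range_nonempty S) ?_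
  rintro _ ⟨i, rfl⟩ _ ⟨j, rfl⟩ hne
  exact hb i j fun h => hne (congrArg S h)

/-! ### Geometric waiting times -/

/-- A cut-off for a geometric variable `G` with success probability `q`: the part of `q * G` below
the cut-off is at most `c`, and the expectation of the part above it is at most `exp (1 - c)`. -/
theorem exists_geometric_cutoff {q : ℝ≥0∞} (hq : q ≤ 1) {c : ℝ} (hc : 0 ≤ c) :
    ∃ j : ℕ, q * j ≤ ENNReal.ofReal c ∧
      q * ∑' n, (1 - q) ^ (n + j) ≤ ENNReal.ofReal (Real.exp (1 - c)) := by
  by_cases hq0 : q = 0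
  · exact ⟨0, by simp [hq0], by simp [hq0]⟩
  have hqt : q ≠ ∞ := ne_top_of_le_ne_top ENNReal.one_ne_top hq
  obtain ⟨p, rfl⟩ : ∃ p : NNReal, q = p := ⟨q.toNNReal, (ENNReal.coe_toNNReal hqt).symm⟩
  have hp0 : 0 < (p : ℝ) := by
    have : p ≠ 0 := by simpa using hq0
    exact_mod_cast pos_iff_ne_zero.2 this
  have hp1 : (p : ℝ) ≤ 1 := by exact_mod_cast hq
  have hfl : (⌊c / p⌋₊ : ℝ) ≤ c / p := Nat.floor_le (by positivity)
  have hfl' : c / p < ⌊c / p⌋₊ + 1 := Nat.lt_floor_add_one _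
  refine ⟨⌊c / p⌋₊, ?_, ?_⟩
  · rw [le_div_iff₀ hp0] at hfl
    rw [← ENNReal.ofReal_coe_nnreal, ← ENNReal.ofReal_natCast, ← ENNReal.ofReal_mul p.coe_nonneg]
    exact ENNReal.ofReal_le_ofReal (by linarith)
  · simp_rw [pow_add]
    rw [ENNReal.tsum_mul_right, ENNReal.tsum_geometric,
      ENNReal.sub_sub_cancel ENNReal.one_ne_top hq, ← mul_assoc, ENNReal.mul_inv_cancel hq0 hqt,
      one_mul, ← ENNReal.ofReal_coe_nnreal, ← ENNReal.ofReal_one, ← ENNReal.ofReal_sub _ p.coe_nonneg,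
      ← ENNReal.ofReal_pow (by linarith)]
    apply ENNReal.ofReal_le_ofReal
    rw [div_lt_iff₀ hp0] at hfl'
    calc (1 - (p : ℝ)) ^ ⌊c / p⌋₊ ≤ Real.exp (-p) ^ ⌊c / p⌋₊ := by
          gcongr
          exact Real.one_sub_le_exp_neg _
      _ = Real.exp (⌊c / p⌋₊ * -p) := (Real.exp_nat_mul _ _).symm
      _ ≤ Real.exp (1 - c) := Real.exp_le_exp.2 (by linarith)

/-- The number `N` of `n` such that the first `n` points avoid `B` is geometric, and the excess of
`ν B * N` over `c` is bounded by a variable of expectation at most `exp (1 - c)`. -/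
theorem exists_avoiding_excess {B : Set Ω} (hB : MeasurableSet B) {c : ℝ} (hc : 0 ≤ c) :
    ∃ X : (ℕ → Ω) → ℝ≥0∞, Measurable X ∧
      (∀ b, ν B * ∑' n, (avoiding B n).indicator 1 b ≤ ENNReal.ofReal c + X b) ∧
      ∫⁻ b, X b ∂Measure.infinitePi (fun _ : ℕ => ν) ≤ ENNReal.ofReal (Real.exp (1 - c)) := by
  obtain ⟨j, hj, hj'⟩ := exists_geometric_cutoff (prob_le_one (μ := ν) (s := B)) hc
  have hm : ∀ n, Measurable ((avoiding B n).indicator (1 : (ℕ → Ω) → ℝ≥0∞)) :=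
    fun n => measurable_one.indicator (measurableSet_avoiding hB n)
  refine ⟨fun b => ν B * ∑' n, (avoiding B (n + j)).indicator 1 b,
    (Measurable.tsum fun n => hm (n + j)).const_mul _, fun b => ?_, ?_⟩
  · rw [← ENNReal.summable.sum_add_tsum_nat_add' (k := j), mul_add]
    gcongr
    refine le_trans ?_ hj
    gcongr
    calc ∑ n ∈ Finset.range j, (avoiding B n).indicator (1 : (ℕ → Ω) → ℝ≥0∞) b
        ≤ ∑ _n ∈ Finset.range j, (1 : ℝ≥0∞) :=
          Finset.sum_le_sum fun n _ => Set.indicator_le_self' (fun _ _ => zero_le) _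
      _ = j := by simp
  · rw [lintegral_const_mul _ (Measurable.tsum fun n => hm (n + j)),
      lintegral_tsum fun n => (hm (n + j)).aemeasurable]
    simp_rw [lintegral_indicator_one (measurableSet_avoiding hB _), infinitePi_avoiding ν hB]
    exact hj'

end SetElimination

/-! ### The expected measure of the winner -/

namespace SetElimination

open scoped ENNReal

variable {Ω : Type*} [MeasurableSpace Ω] {ι : Type*} [Fintype ι]
  (ν : Measure Ω) [IsProbabilityMeasure ν]

theorem ofReal_log_add_excess_le {k : ℕ} (hk : 1 ≤ k) :
    ENNReal.ofReal (2 * Real.log k) +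
      (k - 1 : ℕ) * ENNReal.ofReal (Real.exp (1 - 2 * Real.log k)) ≤
      ENNReal.ofReal (2 * Real.log k + 1) := by
  have hk' : (1 : ℝ) ≤ k := by exact_mod_cast hk
  have hlog : 0 ≤ 2 * Real.log k := by have := Real.log_nonneg hk'; positivity
  rw [← ENNReal.ofReal_natCast, ← ENNReal.ofReal_mul (by positivity),
    ← ENNReal.ofReal_add hlog (by positivity)]
  apply ENNReal.ofReal_le_ofReal
  have he : Real.exp (1 - 2 * Real.log k) = Real.exp 1 / (k : ℝ) ^ 2 := by
    rw [Real.exp_sub, two_mul, Real.exp_add, Real.exp_log (by linarith), sq]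
  have h4 : Real.exp 1 ≤ 4 := by linarith [Real.exp_one_lt_d9]
  have : ((k - 1 : ℕ) : ℝ) * Real.exp (1 - 2 * Real.log k) ≤ 1 := by
    rw [he, mul_div_assoc', div_le_one (by positivity), Nat.cast_sub hk, Nat.cast_one]
    -- Here `4 * (k - 1) ≤ k ^ 2`.
    nlinarith [sq_nonneg ((k : ℝ) - 2), mul_le_mul_of_nonneg_left h4 (sub_nonneg.2 hk')]
  linarith

/-- The expected part of the winner outside a member `S i₀` of the family: a winner other than
`S i₀` requires that `S i₀` is eliminated. The eliminating point is moved to the front, which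
decouples the winner from the round of the elimination, and the number of possible rounds is then
bounded by a geometric variable with success probability `ν (S i \ S i₀)`, where `S i` wins. -/
theorem sum_isWinner_mul_diff_le {S : ι → Set Ω} (hS : ∀ i, MeasurableSet (S i))
    (hinj : Function.Injective S) (i₀ : ι) :
    ∑ i, Measure.infinitePi (fun _ : ℕ => ν) {a | IsWinner (Set.range S) a (S i)} *
        ν (S i \ S i₀) ≤
      ν (S i₀) * ENNReal.ofReal (2 * Real.log (Fintype.card ι) + 1) := by
  classical
  set Q := Measure.infinitePi (fun _ : ℕ => ν)
  set c : ℝ := 2 * Real.log (Fintype.card ι)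
  have hcard : 1 ≤ Fintype.card ι := Fintype.card_pos_iff.2 ⟨i₀⟩
  have hc : 0 ≤ c := by
    have := Real.log_nonneg (x := Fintype.card ι) (by exact_mod_cast hcard)
    positivity
  have hd : ∀ i, MeasurableSet (S i \ S i₀) := fun i => (hS i).diff (hS i₀)
  -- `E n i`: the set `S i` wins and `S i₀` is eliminated in round `n + 1`.
  let E : ℕ → ι → Set (ℕ → Ω) := fun n i => {a | IsWinner (Set.range S) a (S i) ∧
    S i₀ ∈ remaining (Set.range S) a n ∧ S i₀ ∉ remaining (Set.range S) a (n + 1)}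
  -- `F n i`: the same event after the substitution `a = insertAt n z.1 z.2`, enlarged so that the
  -- round `n` occurs only in the condition that the first `n` points avoid `S i \ S i₀`.
  let F : ℕ → ι → Set (Ω × (ℕ → Ω)) := fun n i => {z | z.1 ∈ S i₀ ∧
    IsWinner {T ∈ Set.range S | z.1 ∉ T} z.2 (S i) ∧ z.2 ∈ avoiding (S i \ S i₀) n}
  have hE : ∀ n i, MeasurableSet (E n i) := by
    intro n i
    have hI : ∀ z : ℕ → Ω, (fun _ => Set.range S) z ⊆ Set.range S := fun _ => subset_rfl
    have hIm : ∀ i, MeasurableSet {z : ℕ → Ω | S i ∈ (fun _ => Set.range S) z} :=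
      fun i => .const _
    have hr := measurableSet_mem_remaining hS hI hIm (b := fun z => z) (by fun_prop)
    exact (measurableSet_isWinner hS hI hIm (b := fun z => z) (by fun_prop) i).inter
      ((hr n i₀).inter (hr (n + 1) i₀).compl)
  have hF : ∀ n i, MeasurableSet (F n i) := by
    intro n i
    refine (measurable_fst (hS i₀)).inter (.inter ?_
      (measurable_snd (measurableSet_avoiding (hd i) n)))
    refine measurableSet_isWinner hS (I := fun z : Ω × (ℕ → Ω) => {T ∈ Set.range S | z.1 ∉ T})
      (fun z => Set.sep_subset _ _) (fun j => ?_) (b := fun z => z.2) (by fun_prop) i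
    have : {z : Ω × (ℕ → Ω) | S j ∈ {T ∈ Set.range S | z.1 ∉ T}} =
        (Prod.fst ⁻¹' S j)ᶜ := by
      ext z; simp
    rw [this]
    exact (measurable_fst (hS j)).compl
  have hEF : ∀ n i, Q (E n i) ≤ ν.prod Q (F n i) := by
    intro n i
    rw [← (measurePreserving_insertAt ν n).measure_preimage (hE n i).nullMeasurableSet]
    refine measure_mono ?_
    rintro ⟨x, b⟩ ⟨hW, hM, hM'⟩
    exact ⟨mem_of_eliminated hM hM', hW.of_insertAt hM hM', fun j hj =>
      hW.notMem_diff hM (Finset.mem_range.1 hj)⟩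
  have hWE : ∀ i, Q {a | IsWinner (Set.range S) a (S i)} * ν (S i \ S i₀) ≤
      ∑' n, Q (E n i) * ν (S i \ S i₀) := by
    intro i
    by_cases hi : i = i₀
    · simp [hi]
    rw [ENNReal.tsum_mul_right]
    gcongr
    refine le_trans (measure_mono fun a ha => ?_) (measure_iUnion_le _)
    obtain ⟨n, hn⟩ := IsWinner.exists_eliminated ha ⟨i₀, rfl⟩ (hinj.ne hi)
    exact Set.mem_iUnion.2 ⟨n, ha, hn⟩
  choose X hXm hX hXint using fun i => exists_avoiding_excess ν (hd i) hc
  -- For fixed `z` at most one set wins the game in which `z.1` has been moved to the front.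
  have hpoint : ∀ z : Ω × (ℕ → Ω), ∑ i, ∑' n, (F n i).indicator 1 z * ν (S i \ S i₀) ≤
      (S i₀).indicator 1 z.1 *
        (ENNReal.ofReal c + ∑ i ∈ Finset.univ.erase i₀, X i z.2) := by
    intro z
    by_cases hz : z.1 ∈ S i₀ ∧ ∃ i, IsWinner {T ∈ Set.range S | z.1 ∉ T} z.2 (S i)
    · obtain ⟨hz, i, hi⟩ := hz
      rw [Set.indicator_of_mem hz, Pi.one_apply, one_mul, Finset.sum_eq_single i]
      · by_cases hii : i = i₀
        · simp [hii]
        calc ∑' n, (F n i).indicator 1 z * ν (S i \ S i₀)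
            ≤ ∑' n, (avoiding (S i \ S i₀) n).indicator 1 z.2 * ν (S i \ S i₀) := by
              refine ENNReal.tsum_le_tsum fun n => ?_
              gcongr
              by_cases h : z ∈ F n i
              · rw [Set.indicator_of_mem h, Set.indicator_of_mem h.2.2]; rfl
              · rw [Set.indicator_of_notMem h]; exact zero_le
          _ ≤ ENNReal.ofReal c + X i z.2 := by
              rw [ENNReal.tsum_mul_right, mul_comm]
              exact hX i z.2
          _ ≤ _ := by
              gcongr
              exact Finset.single_le_sum (f := fun i => X i z.2) (fun _ _ => zero_le)
                (Finset.mem_erase.2 ⟨hii, Finset.mem_univ i⟩)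
      · intro j _ hj
        have : ∀ n, z ∉ F n j := fun n h => hj (hinj (h.2.1.unique hi))
        simp [this]
      · simp
    · have : ∀ n i, z ∉ F n i := fun n i h => hz ⟨h.1, i, h.2.1⟩
      simp [this]
  calc ∑ i, Q {a | IsWinner (Set.range S) a (S i)} * ν (S i \ S i₀)
      ≤ ∑ i, ∑' n, ν.prod Q (F n i) * ν (S i \ S i₀) :=
        Finset.sum_le_sum fun i _ => (hWE i).trans
          (ENNReal.tsum_le_tsum fun n => by gcongr; exact hEF n i)
    _ = ∫⁻ z, ∑ i, ∑' n, (F n i).indicator 1 z * ν (S i \ S i₀) ∂ν.prod Q := by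
        have hm : ∀ n i, Measurable fun z =>
            (F n i).indicator (1 : Ω × (ℕ → Ω) → ℝ≥0∞) z * ν (S i \ S i₀) :=
          fun n i => (measurable_one.indicator (hF n i)).mul_const _
        rw [lintegral_finsetSum _ fun i _ => Measurable.tsum fun n => hm n i]
        refine Finset.sum_congr rfl fun i _ => ?_
        rw [lintegral_tsum fun n => (hm n i).aemeasurable]
        refine tsum_congr fun n => ?_
        rw [lintegral_mul_const _ (measurable_one.indicator (hF n i)),
          lintegral_indicator_one (hF n i)]
    _ ≤ ∫⁻ z, (S i₀).indicator 1 z.1 *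
          (ENNReal.ofReal c + ∑ i ∈ Finset.univ.erase i₀, X i z.2) ∂ν.prod Q :=
        lintegral_mono hpoint
    _ = ν (S i₀) * (ENNReal.ofReal c + ∑ i ∈ Finset.univ.erase i₀, ∫⁻ b, X i b ∂Q) := by
        have hsum : Measurable fun b => ∑ i ∈ Finset.univ.erase i₀, X i b :=
          Finset.measurable_sum _ fun i _ => hXm i
        rw [lintegral_prod_mul (f := (S i₀).indicator 1)
          (measurable_one.indicator (hS i₀)).aemeasurable (hsum.const_add _).aemeasurable,
          lintegral_indicator_one (hS i₀), lintegral_add_left measurable_const,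
          lintegral_const, measure_univ, mul_one, lintegral_finsetSum _ fun i _ => hXm i]
    _ ≤ ν (S i₀) * (ENNReal.ofReal c +
          (Fintype.card ι - 1 : ℕ) * ENNReal.ofReal (Real.exp (1 - c))) := by
        gcongr
        refine (Finset.sum_le_card_nsmul _ _ _ fun i _ => hXint i).trans ?_
        rw [Finset.card_erase_of_mem (Finset.mem_univ i₀), Finset.card_univ, nsmul_eq_mul]
    _ ≤ ν (S i₀) * ENNReal.ofReal (c + 1) := by
        gcongr
        exact ofReal_log_add_excess_le hcard

theorem measureReal_win_eq (μ : Measure Ω) {S : ι → Set Ω}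
    (hinj : Function.Injective S) (a : ℕ → Ω) :
    μ.real (win (Set.range S) a) =
      ∑ i, {b | IsWinner (Set.range S) b (S i)}.indicator (fun _ => μ.real (S i)) a := by
  classical
  by_cases h : ∃ W, IsWinner (Set.range S) a W
  · obtain ⟨W, hW⟩ := h
    obtain ⟨i, rfl⟩ := hW.mem
    have hmem : a ∈ {b | IsWinner (Set.range S) b (S i)} := hW
    rw [hW.win_eq, Finset.sum_eq_single i, Set.indicator_of_mem hmem]
    · intro j _ hj
      have hmem' : a ∉ {b | IsWinner (Set.range S) b (S j)} :=
        fun h => hj (hinj (IsWinner.unique h hW))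
      rw [Set.indicator_of_notMem hmem']
    · simp
  · rw [win_eq_empty h, measureReal_empty, Finset.sum_eq_zero fun i _ => ?_]
    have hmem : a ∉ {b | IsWinner (Set.range S) b (S i)} := fun h' => h ⟨_, h'⟩
    rw [Set.indicator_of_notMem hmem]

end SetElimination

open SetElimination

theorem theorem1 {Ω : Type*} [MeasurableSpace Ω] (μ : Measure Ω) [IsFiniteMeasure μ]
    (k : ℕ) (hk : 1 ≤ k) (S : Fin k → Set Ω)
    (hS : ∀ i, MeasurableSet (S i))
    (hS_pos : ∀ i, 0 < μ (S i))
    (hS_diff : ∀ i j, i ≠ j → 0 < μ (symmDiff (S i) (S j)))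
    {Ξ : Type*} [MeasurableSpace Ξ] (P : Measure Ξ) [IsProbabilityMeasure P]
    (ω : ℕ → Ξ → Ω) (hω_meas : ∀ n, Measurable (ω n))
    (hω_indep : iIndepFun ω P)
    (hω_law : ∀ n, P.map (ω n) = (μ Set.univ)⁻¹ • μ) :
    (∀ᵐ x ∂P, ∃ W, SetElimination.IsWinner (Set.range S) (fun n => ω n x) W) ∧
    Integrable (fun x => μ.real (SetElimination.win (Set.range S) (fun n => ω n x))) P ∧
    ∫ x, μ.real (SetElimination.win (Set.range S) (fun n => ω n x)) ∂P
      ≤ (2 * Real.log k + 2) * ⨅ i, μ.real (S i) := by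
  have : Nonempty (Fin k) := ⟨⟨0, hk⟩⟩
  have : NeZero μ := ⟨fun h => by simpa [h] using hS_pos ⟨0, hk⟩⟩
  set ν : Measure Ω := (μ Set.univ)⁻¹ • μ with hν
  have hinj : Function.Injective S := by
    intro i j hij
    by_contra hne
    simpa [hij] using hS_diff i j hne
  have hseq : Measurable fun x n => ω n x := measurable_pi_lambda _ hω_meas
  have hlaw : P.map (fun x n => ω n x) = Measure.infinitePi fun _ : ℕ => ν := by
    rw [hω_indep.map_fun_eq_infinitePi_map hω_meas]
    congr 1
    funext n
    exact hω_law n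
  have hpos : 0 < (μ Set.univ)⁻¹ := ENNReal.inv_pos.2 (measure_ne_top μ _)
  have hW : ∀ i, MeasurableSet {a : ℕ → Ω | IsWinner (Set.range S) a (S i)} := fun i =>
    measurableSet_isWinner hS (I := fun _ => Set.range S) (fun _ => subset_rfl)
      (fun _ => .const _) (b := fun a => a) (by fun_prop) i
  have hWx : ∀ i, MeasurableSet {x | IsWinner (Set.range S) (fun n => ω n x) (S i)} :=
    fun i => hseq (hW i)
  have hwin : ∀ x, μ.real (win (Set.range S) fun n => ω n x) =
      ∑ i, {x | IsWinner (Set.range S) (fun n => ω n x) (S i)}.indicator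
        (fun _ => μ.real (S i)) x := fun x => measureReal_win_eq μ hinj _
  have hint : ∀ i, Integrable ({x | IsWinner (Set.range S) (fun n => ω n x) (S i)}.indicator
      fun _ => μ.real (S i)) P := fun i => (integrable_const _).indicator (hWx i)
  refine ⟨?_, ?_, ?_⟩
  · have h := ae_exists_isWinner ν hS fun i j hij => by
      rw [hν, Measure.smul_apply, smul_eq_mul]
      exact ENNReal.mul_pos hpos.ne' (hS_diff i j hij).ne'
    rw [← hlaw] at h
    exact ae_of_ae_map hseq.aemeasurable h
  · simp_rw [hwin]
    exact integrable_finsetSum _ fun i _ => hint i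
  · obtain ⟨i₀, hi₀⟩ := exists_eq_ciInf_of_finite (f := fun i => μ.real (S i))
    rw [← hi₀]
    simp_rw [hwin]
    rw [integral_finsetSum _ fun i _ => hint i]
    simp_rw [integral_indicator_const _ (hWx _), smul_eq_mul]
    set p : Fin k → ℝ := fun i => P.real {x | IsWinner (Set.range S) (fun n => ω n x) (S i)}
      with hp
    have hp1 : ∑ i, p i ≤ 1 := by
      refine (sum_measureReal_le_measureReal_univ (fun i _ => hWx i) ?_).trans_eq (by simp)
      intro i _ j _ hij
      exact Set.disjoint_left.2 fun x hi hj => hij (hinj (IsWinner.unique hi hj))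
    have hdiff : ∑ i, p i * μ.real (S i \ S i₀) ≤ μ.real (S i₀) * (2 * Real.log k + 1) := by
      have hlog : 0 ≤ Real.log k := Real.log_nonneg (by exact_mod_cast hk)
      have h := ENNReal.toReal_mono (by finiteness) (sum_isWinner_mul_diff_le ν hS hinj i₀)
      rw [ENNReal.toReal_sum fun _ _ => by finiteness, ← hlaw, ENNReal.toReal_mul,
        Fintype.card_fin, ENNReal.toReal_ofReal (by positivity)] at h
      have hu : 0 < ((μ Set.univ)⁻¹).toReal :=
        ENNReal.toReal_pos hpos.ne' (ENNReal.inv_ne_top.2 (NeZero.ne _))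
      simp_rw [ENNReal.toReal_mul, Measure.map_apply hseq (hW _), hν, Measure.smul_apply,
        smul_eq_mul, ENNReal.toReal_mul, mul_left_comm _ ((μ Set.univ)⁻¹).toReal,
        ← Finset.mul_sum, mul_assoc] at h
      exact le_of_mul_le_mul_left h hu
    calc ∑ i, p i * μ.real (S i)
        ≤ ∑ i, (p i * μ.real (S i \ S i₀) + p i * μ.real (S i₀)) := by
          refine Finset.sum_le_sum fun i _ => ?_
          rw [← mul_add]
          gcongr
          rw [← measureReal_sdiff_add_inter (hS i₀)]
          exact add_le_add le_rfl (measureReal_mono Set.inter_subset_right)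
      _ ≤ μ.real (S i₀) * (2 * Real.log k + 1) + 1 * μ.real (S i₀) := by
          rw [Finset.sum_add_distrib, ← Finset.sum_mul]
          gcongr
      _ = (2 * Real.log k + 2) * μ.real (S i₀) := by ring
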